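/- Semifields are commutative and have no zero element: a semifield is an abelian group $(H,\cdot)$ with a commutative, associative addition over which multiplication distributes; homomorphisms are the maps preserving $+$ and $\cdot$. A kernel of an idempotent semifield $H$ is a subgroup $K$ of $(H,\cdot)$ such that $xa+yb\in K$ whenever $a,b\in K$, $x,y\in H$ and $x+y=1$; it is itself a semifield, and $H/K$ denotes the quotient group with addition $aK+bK=(a+b)K$. For $a\in H$, $\langle a\rangle$ is the smallest kernel containing $a$ (a principal kernel). Let $\mathscr R$ be a totally ordered abelian group, written multiplicatively, with addition $a+b=\max(a,b)$, which is divisible, archimedean and conditionally complete as an ordered set. Let $n\ge 0$, and let $\mathscr R(x_1,\dots,x_n)$ be the semifield of all functions $\mathscr R^n\to\mathscr R$ of the form $p/q$, where $p,q$ are functions given by polynomials in $\mathscr R[x_1,\dots,x_n]$ (non-empty finite sums of monomials $\alpha x_1^{k_1}\cdots x_n^{k_n}$ with $\alpha\in\mathscr R$, $k_i\in\mathbb N$), with pointwise operations. Let $\langle\mathscr R\rangle$ be the kernel of $\mathscr R(x_1,\dots,x_n)$ generated by the constant functions, regarded as a semifield in its own right. Let $f\in\langle\mathscr R\rangle$,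 let $\langle f\rangle$ be the principal kernel of $\langle\mathscr R\rangle$ generated by $f$, and let $$V=\mathrm{Skel}(\langle f\rangle)=\{a\in\mathscr R^n : g(a)=1 \text{ for all } g\in\langle f\rangle\}.$$ Let $\mathscr R[V]=\{g|_V : g\in\langle\mathscr R\rangle\}$ be the coordinate semifield of $V$, with pointwise operations. Then the restriction map $$\phi_V:\langle\mathscr R\rangle\to\mathscr R[V],\qquad g\mapsto g|_V,$$ is a surjective semifield homomorphism with $\{g\in\langle\mathscr R\rangle : \phi_V(g)=1\}=\langle f\rangle$. Hence $g\langle f\rangle\mapsto g|_V$ is a well-defined isomorphism of semifields $$\langle\mathscr R\rangle/\langle f\rangle\;\cong\;\mathscr R[V].$$ -/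

import Mathlib

/-- A commutative semifield without a zero element: a commutative multiplicative group with a
commutative and associative addition over which multiplication distributes. -/
class ZeroFreeSemifield (H : Type*) extends CommGroup H, AddCommSemigroup H, Distrib H

/-- The semifield is idempotent: `1 + 1 = 1`, equivalently `a + a = a` for all `a`. -/
class IsIdempotentSemifield (H : Type*) [ZeroFreeSemifield H] : Prop where
  one_add_one : (1 : H) + 1 = 1

/-- Semifield homomorphisms: maps that preserve multiplication and addition. -/
structure IsSemifieldHom {H L : Type*} [ZeroFreeSemifield H] [ZeroFreeSemifield L]
    (φ : H → L) : Prop where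
  map_mul : ∀ a b, φ (a * b) = φ a * φ b
  map_add : ∀ a b, φ (a + b) = φ a + φ b

/-- The semifield `Fun(X, H)` of all functions from `X` to `H`, with pointwise operations. -/
instance Pi.instZeroFreeSemifield {X H : Type*} [ZeroFreeSemifield H] :
    ZeroFreeSemifield (X → H) :=
  { (inferInstance : CommGroup (X → H)), (inferInstance : AddCommSemigroup (X → H)) with
    left_distrib := fun f g h => funext fun x => left_distrib (f x) (g x) (h x)
    right_distrib := fun f g h => funext fun x => right_distrib (f x) (g x) (h x) }

/-! ### Sub-semifields -/

/-- A sub-semifield: a subgroup that is closed under addition. -/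
structure SubSemifield (H : Type*) [ZeroFreeSemifield H] extends Subgroup H where
  add_mem' : ∀ {a b : H}, a ∈ carrier → b ∈ carrier → a + b ∈ carrier

namespace SubSemifield

variable {H : Type*} [ZeroFreeSemifield H]

instance : SetLike (SubSemifield H) H where
  coe S := S.carrier
  coe_injective S T h := by
    cases S; cases T; congr; exact SetLike.coe_injective h

instance : SubgroupClass (SubSemifield H) H where
  mul_mem {S} := S.toSubgroup.mul_mem
  one_mem S := S.toSubgroup.one_mem
  inv_mem {S} := S.toSubgroup.inv_mem

instance (S : SubSemifield H) : Add S := ⟨fun a b => ⟨a + b, S.add_mem' a.2 b.2⟩⟩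

instance (S : SubSemifield H) : ZeroFreeSemifield S :=
  { (inferInstance : CommGroup S), (inferInstance : Add S) with
    add_assoc := fun a b c => Subtype.ext (add_assoc (a : H) b c)
    add_comm := fun a b => Subtype.ext (add_comm (a : H) b)
    left_distrib := fun a b c => Subtype.ext (left_distrib (a : H) b c)
    right_distrib := fun a b c => Subtype.ext (right_distrib (a : H) b c) }

instance [IsIdempotentSemifield H] (S : SubSemifield H) : IsIdempotentSemifield S :=
  ⟨Subtype.ext (IsIdempotentSemifield.one_add_one (H := H))⟩

end SubSemifield

/-! ### Kernels of a semifield and quotients by them -/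

/-- A kernel of a semifield: a (normal) subgroup `K` such that `x a + y b ∈ K` whenever
`a, b ∈ K` and `x + y = 1`. -/
structure SemifieldKernel (H : Type*) [ZeroFreeSemifield H] extends Subgroup H where
  convex' : ∀ {x y a b : H}, x + y = 1 → a ∈ carrier → b ∈ carrier → x * a + y * b ∈ carrier

namespace SemifieldKernel

variable {H : Type*} [ZeroFreeSemifield H]

instance : SetLike (SemifieldKernel H) H where
  coe K := K.carrier
  coe_injective K L h := by
    cases K; cases L; congr; exact SetLike.coe_injective h

/-- The kernel generated by a set `A`: the intersection of all kernels that contain `A`. -/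
def closure (A : Set H) : SemifieldKernel H where
  carrier := {h | ∀ K : SemifieldKernel H, A ⊆ K → h ∈ K}
  mul_mem' ha hb K hK := K.toSubgroup.mul_mem (ha K hK) (hb K hK)
  one_mem' K _ := K.toSubgroup.one_mem
  inv_mem' ha K hK := K.toSubgroup.inv_mem (ha K hK)
  convex' hxy ha hb K hK := K.convex' hxy (ha K hK) (hb K hK)

/-- The principal kernel `⟨a⟩`. -/
def principal (a : H) : SemifieldKernel H := closure {a}

/-- In an idempotent semifield every kernel is a sub-semifield. -/
def toSubSemifield [IsIdempotentSemifield H] (K : SemifieldKernel H) : SubSemifield H :=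
  { K.toSubgroup with
    add_mem' := fun {a b} ha hb => by
      have h := K.convex' (IsIdempotentSemifield.one_add_one (H := H)) ha hb
      rwa [one_mul, one_mul] at h }

/-- The quotient of a semifield by a kernel: the quotient group, with
`aK + bK = (a + b)K`. -/
def Quotient (K : SemifieldKernel H) : Type _ := H ⧸ K.toSubgroup

namespace Quotient

variable (K : SemifieldKernel H)

instance : CommGroup K.Quotient := inferInstanceAs (CommGroup (H ⧸ K.toSubgroup))

/-- The quotient map `a ↦ aK`. -/
def mk (a : H) : K.Quotient := (QuotientGroup.mk a : H ⧸ K.toSubgroup)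

/-- Addition of cosets is well defined, since
`(a' + b') / (a + b) = (a / (a + b)) * (a' / a) + (b / (a + b)) * (b' / b)`. -/
theorem add_wd {a a' b b' : H} (ha : a⁻¹ * a' ∈ K.toSubgroup) (hb : b⁻¹ * b' ∈ K.toSubgroup) :
    (a + b)⁻¹ * (a' + b') ∈ K.toSubgroup := by
  have h1 : (a + b)⁻¹ * a + (a + b)⁻¹ * b = 1 := by
    rw [← mul_add, inv_mul_cancel]
  have h2 := K.convex' h1 ha hb
  rw [mul_assoc, mul_inv_cancel_left, mul_assoc, mul_inv_cancel_left, ← mul_add] at h2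
  exact h2

instance : Add K.Quotient where
  add := Quotient.map₂ (· + ·) (by
    intro a a' ha b b' hb
    rw [← Quotient.eq_iff_equiv] at *
    exact QuotientGroup.eq.2 (add_wd K (QuotientGroup.eq.1 ha) (QuotientGroup.eq.1 hb)))

instance : ZeroFreeSemifield K.Quotient :=
  { (inferInstance : CommGroup K.Quotient), (inferInstance : Add K.Quotient) with
    add_assoc := by
      rintro ⟨a⟩ ⟨b⟩ ⟨c⟩; exact congrArg (mk K) (add_assoc a b c)
    add_comm := by
      rintro ⟨a⟩ ⟨b⟩; exact congrArg (mk K) (add_comm a b)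
    left_distrib := by
      rintro ⟨a⟩ ⟨b⟩ ⟨c⟩; exact congrArg (mk K) (left_distrib a b c)
    right_distrib := by
      rintro ⟨a⟩ ⟨b⟩ ⟨c⟩; exact congrArg (mk K) (right_distrib a b c) }

end Quotient

end SemifieldKernel

/-! ### The base semifield -/

/-- A bipotent (max-)semifield: a totally ordered commutative group in which the sum of two
elements is their maximum. -/
class MaxSemifield (R : Type*) extends CommGroup R, LinearOrder R, IsOrderedMonoid R, Add R where
  add_eq_max : ∀ a b : R, a + b = max a b

instance MaxSemifield.toZeroFreeSemifield {R : Type*} [MaxSemifield R] : ZeroFreeSemifield R :=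
  { ‹MaxSemifield R› with
    add_assoc := fun a b c => by simp only [MaxSemifield.add_eq_max, max_assoc]
    add_comm := fun a b => by simp only [MaxSemifield.add_eq_max, max_comm]
    left_distrib := fun a b c => by
      simp only [MaxSemifield.add_eq_max]; exact (max_mul_mul_left a b c).symm
    right_distrib := fun a b c => by
      simp only [MaxSemifield.add_eq_max]; exact (max_mul_mul_right a b c).symm }

instance {R : Type*} [MaxSemifield R] : IsIdempotentSemifield R :=
  ⟨by rw [MaxSemifield.add_eq_max, max_self]⟩

instance {X H : Type*} [ZeroFreeSemifield H] [IsIdempotentSemifield H] :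
    IsIdempotentSemifield (X → H) :=
  ⟨funext fun _ => IsIdempotentSemifield.one_add_one (H := H)⟩

/-- The designated base semifield: bipotent, divisible, archimedean and (conditionally)
complete. -/
class DesignatedSemifield (R : Type*) extends MaxSemifield R where
  divisible : ∀ m : ℕ, m ≠ 0 → ∀ a : R, ∃ b : R, b ^ m = a
  archimedean : ∀ a b : R, (∀ k : ℤ, a ^ k ≤ b) → a = 1
  exists_isLUB : ∀ S : Set R, S.Nonempty → BddAbove S → ∃ s, IsLUB S s
  exists_isGLB : ∀ S : Set R, S.Nonempty → BddBelow S → ∃ s, IsGLB S s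

/-! ### Polynomial functions and the semifield of fractions -/

/-- The functions `Rⁿ → R` given by polynomials in `R[x₁, …, xₙ]`, i.e. by non-empty finite sums
of monomials `α x₁^{k₁} ⋯ xₙ^{kₙ}` (without zero element in `R`, there is no zero polynomial). -/
inductive IsPolynomialFun {n : ℕ} {R : Type*} [MaxSemifield R] : ((Fin n → R) → R) → Prop
  | monomial (α : R) (k : Fin n → ℕ) : IsPolynomialFun (fun x => α * ∏ i, x i ^ k i)
  | add {p q : (Fin n → R) → R} : IsPolynomialFun p → IsPolynomialFun q → IsPolynomialFun (p + q)

namespace IsPolynomialFun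

variable {n : ℕ} {R : Type*} [MaxSemifield R]

theorem const (α : R) : IsPolynomialFun (fun _ : Fin n → R => α) := by
  simpa using IsPolynomialFun.monomial (n := n) α 0

theorem mul {p q : (Fin n → R) → R} (hp : IsPolynomialFun p) (hq : IsPolynomialFun q) :
    IsPolynomialFun (p * q) := by
  induction hp with
  | monomial α k =>
    induction hq with
    | monomial β l =>
      have h := IsPolynomialFun.monomial (α * β) (k + l)
      have e : (fun x : Fin n → R => α * β * ∏ i, x i ^ (k + l) i) =
          (fun x => α * ∏ i, x i ^ k i) * (fun x => β * ∏ i, x i ^ l i) := by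
        funext x
        simp only [Pi.mul_apply, Pi.add_apply, pow_add, Finset.prod_mul_distrib]
        exact mul_mul_mul_comm _ _ _ _
      rwa [e] at h
    | add _ _ h1 h2 => rw [left_distrib]; exact h1.add h2
  | add _ _ h1 h2 => rw [right_distrib]; exact h1.add h2

end IsPolynomialFun

section Fractions

variable (n : ℕ) (R : Type*)

/-- The semifield of fractions `R(x₁, …, xₙ)` of `R[x₁, …, xₙ]`, considered inside
`Fun(Rⁿ, R)`: all quotients of polynomial functions. -/
def fractionSemifield [MaxSemifield R] : SubSemifield ((Fin n → R) → R) where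
  carrier := {f | ∃ p q, IsPolynomialFun p ∧ IsPolynomialFun q ∧ f = p / q}
  mul_mem' := by
    rintro _ _ ⟨p, q, hp, hq, rfl⟩ ⟨p', q', hp', hq', rfl⟩
    exact ⟨p * p', q * q', hp.mul hp', hq.mul hq', div_mul_div_comm _ _ _ _⟩
  one_mem' := ⟨_, _, IsPolynomialFun.const 1, IsPolynomialFun.const 1, (div_self' _).symm⟩
  inv_mem' := by
    rintro _ ⟨p, q, hp, hq, rfl⟩
    exact ⟨q, p, hq, hp, inv_div _ _⟩
  add_mem' := by
    rintro _ _ ⟨p, q, hp, hq, rfl⟩ ⟨p', q', hp', hq', rfl⟩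
    refine ⟨p * q' + p' * q, q * q', (hp.mul hq').add (hp'.mul hq), hq.mul hq', ?_⟩
    rw [eq_div_iff_mul_eq', right_distrib]
    congr 1
    · rw [← mul_assoc, div_mul_cancel]
    · rw [mul_comm q q', ← mul_assoc, div_mul_cancel]

/-- The constant functions, as elements of `R(x₁, …, xₙ)`. -/
def fractionConst [MaxSemifield R] (α : R) : fractionSemifield n R :=
  ⟨fun _ => α, _, _, IsPolynomialFun.const α, IsPolynomialFun.const 1, (div_one _).symm⟩

/-- `⟨R⟩`, the kernel of `R(x₁, …, xₙ)` generated by the constants.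
For archimedean `R` it is generated by any single constant `α ≠ 1`. -/
def constKernel [MaxSemifield R] : SemifieldKernel (fractionSemifield n R) :=
  SemifieldKernel.closure (Set.range (fractionConst n R))

/-- The kernel `⟨R⟩` of `R(x₁, …, xₙ)`, as a semifield in its own right. -/
abbrev ConstSemifield [MaxSemifield R] : Type _ := (constKernel n R).toSubSemifield

end Fractions

section Skeletons

variable {n : ℕ} {R : Type*} [MaxSemifield R]

/-- The function `Rⁿ → R` underlying an element of `⟨R⟩`. -/
def ConstSemifield.eval (g : ConstSemifield n R) : (Fin n → R) → R := g.1.1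

/-- The skeleton of a subset `S` of `⟨R⟩`. -/
def skel (S : Set (ConstSemifield n R)) : Set (Fin n → R) :=
  {a | ∀ g ∈ S, g.eval a = 1}

/-- The coordinate semifield `R[V] = {g|_V : g ∈ ⟨R⟩}`, inside `Fun(V, R)`. -/
def coordinateSemifield (V : Set (Fin n → R)) : SubSemifield (V → R) where
  carrier := {h | ∃ g : ConstSemifield n R, V.domRestrict g.eval = h}
  mul_mem' := by rintro _ _ ⟨g, rfl⟩ ⟨g', rfl⟩; exact ⟨g * g', rfl⟩
  one_mem' := ⟨1, rfl⟩
  inv_mem' := by rintro _ ⟨g, rfl⟩; exact ⟨g⁻¹, rfl⟩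
  add_mem' := by rintro _ _ ⟨g, rfl⟩ ⟨g', rfl⟩; exact ⟨g + g', rfl⟩

/-- The restriction map `φ_V : ⟨R⟩ → R[V]`, `g ↦ g|_V`. -/
def restrictionMap (V : Set (Fin n → R)) (g : ConstSemifield n R) : coordinateSemifield V :=
  ⟨V.domRestrict g.eval, g, rfl⟩

end Skeletons

/-! The substance is a Nullstellensatz: if `g ∈ ⟨R⟩` equals 1 wherever `f` does, then `g ∈ ⟨f⟩`; the
rest is the first isomorphism theorem. Write |h| = h + h⁻¹ = max(h, h⁻¹). Kernels are order convex,
so it is enough to find k with |g| ≤ |f|^k pointwise (`mem_principal_of_forall_eval_eq_one`).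

In additive notation |f| and |g| are differences of maxima of finitely many affine forms with
integer slopes, so Rⁿ is covered by finitely many polyhedra on each of which both are affine
(`exists_le_nsmul_of_piecewise_affine`). On one of them the system f ≤ 0, g > 0 has no solution.
Farkas' lemma, proved by Fourier–Motzkin elimination, then yields a constant c and naturals μ, ν
with c + νg ≤ μf on the polyhedron, where either c ≥ 0 and ν ≥ 1, or c > 0. In the first case g ≤
μf. In the second c ≤ μf, and since g is bounded by some C, the archimedean property gives g ≤ C ≤
Nc ≤ Nμf (`exists_le_nsmul_of_affine`).

Boundedness is the reason for working in `⟨R⟩`: in R(x₁, …, xₙ) a constant α ≠ 1 has empty skeleton,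
yet the unbounded x₁ is not in ⟨α⟩. -/

/-! ### Fourier–Motzkin elimination over a divisible ordered group -/

section FourierMotzkin

/-- `a < c` if the flag `b` is set, and `a ≤ c` otherwise. -/
def FlaggedLE {A : Type*} [LinearOrder A] (b : Bool) (a c : A) : Prop := if b then a < c else a ≤ c

theorem FlaggedLE.le {A : Type*} [LinearOrder A] {b : Bool} {a c : A}
    (h : FlaggedLE b a c) : a ≤ c := by
  cases b
  · simpa [FlaggedLE] using h
  · exact (show a < c by simpa [FlaggedLE] using h).le

theorem FlaggedLE.of_lt {A : Type*} [LinearOrder A] {b : Bool} {a c : A}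
    (h : a < c) : FlaggedLE b a c := by
  cases b
  · simpa [FlaggedLE] using h.le
  · simpa [FlaggedLE] using h

theorem flaggedLE_self {A : Type*} [LinearOrder A] {b : Bool} {a : A} :
    FlaggedLE b a a ↔ b = false := by
  cases b <;> simp [FlaggedLE]

/-- The value at `x` of the affine form with constant term `φ.1` and integer slopes `φ.2`. -/
def affineEval {ι A : Type*} [Fintype ι] [AddCommGroup A] (x : ι → A) : A × (ι → ℤ) →+ A where
  toFun φ := φ.1 + ∑ i, φ.2 i • x i
  map_zero' := by simp
  map_add' φ ψ := by
    simp only [Prod.fst_add, Prod.snd_add, Pi.add_apply, add_smul, Finset.sum_add_distrib]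
    abel

theorem affineEval_apply {ι A : Type*} [Fintype ι] [AddCommGroup A] (x : ι → A)
    (φ : A × (ι → ℤ)) :
    affineEval x φ = φ.1 + ∑ i, φ.2 i • x i := rfl

/-- Freezes all coordinates but one, so that a system in many unknowns becomes a system in the
single unknown t. -/
theorem affineEval_update {ι A : Type*} [Fintype ι] [AddCommGroup A] [DecidableEq ι]
    (x : ι → A) (i : ι) (t : A) (φ : A × (ι → ℤ)) :
    affineEval (Function.update x i (x i + t)) φ = affineEval x φ + φ.2 i • t := by
  have e : Function.update x i (x i + t) = x + Pi.single i t := by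
    ext j
    by_cases hj : j = i
    · subst hj; simp
    · simp [hj]
  have e2 : ∑ j, φ.2 j • (Pi.single i t : ι → A) j = φ.2 i • t := by
    rw [Finset.sum_eq_single i]
    · simp
    · intro j _ hj; simp [hj]
    · simp
  simp only [affineEval_apply, e, Pi.add_apply, smul_add, Finset.sum_add_distrib, e2, add_assoc]

variable {A : Type*} [AddCommGroup A] [LinearOrder A] [IsOrderedAddMonoid A]

variable {ι : Type*} [Fintype ι]

theorem flaggedLE_nsmul_sub {b : Bool} {a c : A} {m : ℕ} (hm : m ≠ 0) :
    FlaggedLE b (m • (a - c)) 0 ↔ FlaggedLE b a c := by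
  cases b
  · simp only [FlaggedLE, Bool.false_eq_true, if_false, nsmul_nonpos_iff hm, sub_nonpos]
  · simp only [FlaggedLE, if_true, nsmul_neg_iff hm, sub_neg]

/-- The midpoint exists: t is chosen with 2t = a + c. -/
theorem exists_between_of_divisible (hdiv : ∀ m : ℕ, m ≠ 0 → ∀ a : A, ∃ b : A, m • b = a)
    {a c : A} (h : a < c) : ∃ t, a < t ∧ t < c := by
  obtain ⟨t, ht⟩ := hdiv 2 two_ne_zero (a + c)
  rw [two_nsmul] at ht
  refine ⟨t, lt_of_not_ge fun h' => ?_, lt_of_not_ge fun h' => ?_⟩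
  · exact absurd ht (ne_of_lt ((add_le_add h' h').trans_lt (add_lt_add_right h a)))
  · exact absurd ht (ne_of_gt ((add_lt_add_left h c).trans_le (add_le_add h' h')))

/-- Finitely many lower and upper bounds that are pairwise compatible have a common solution. -/
theorem exists_flaggedLE_between [Nontrivial A]
    (hdiv : ∀ m : ℕ, m ≠ 0 → ∀ a : A, ∃ b : A, m • b = a) {κ : Type*} (L U : Finset κ)
    (r : κ → A) (b : κ → Bool)
    (h : ∀ l ∈ L, ∀ u ∈ U, FlaggedLE (b l || b u) (r l) (r u)) :
    ∃ t, (∀ l ∈ L, FlaggedLE (b l) (r l) t) ∧ ∀ u ∈ U, FlaggedLE (b u) t (r u) := by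
  -- The margin ε meets strict bounds when no bound on the opposite side is present.
  obtain ⟨ε, hε⟩ := exists_zero_lt (α := A)
  rcases L.eq_empty_or_nonempty with rfl | hL
  · rcases U.eq_empty_or_nonempty with rfl | hU
    · exact ⟨0, by simp, by simp⟩
    · obtain ⟨u, -, hu⟩ := U.exists_min_image r hU
      exact ⟨r u - ε, by simp, fun v hv => .of_lt ((sub_lt_self _ hε).trans_le (hu v hv))⟩
  · obtain ⟨l, hl, hl'⟩ := L.exists_max_image r hL
    rcases U.eq_empty_or_nonempty with rfl | hU
    · exact ⟨r l + ε, fun v hv => .of_lt ((hl' v hv).trans_lt (lt_add_of_pos_right _ hε)), by simp⟩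
    · obtain ⟨u, hu, hu'⟩ := U.exists_min_image r hU
      rcases (h l hl u hu).le.lt_or_eq with hlt | heq
      · obtain ⟨t, h1, h2⟩ := exists_between_of_divisible hdiv hlt
        exact ⟨t, fun v hv => .of_lt ((hl' v hv).trans_lt h1),
          fun v hv => .of_lt (h2.trans_le (hu' v hv))⟩
      -- The largest lower bound equals the smallest upper bound, which forces t. Any bound attained
      -- there must be weak, since its pairing with an opposite extremal bound is an equality.
      · refine ⟨r l, fun v hv => ?_, fun v hv => ?_⟩
        · rcases (hl' v hv).lt_or_eq with hlt | he
          · exact .of_lt hlt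
          · have := h v hv u hu
            rw [he, heq, flaggedLE_self, Bool.or_eq_false_iff] at this
            rw [he, flaggedLE_self]
            exact this.1
        · rcases (hu' v hv).lt_or_eq with hlt | he
          · exact .of_lt (heq ▸ hlt)
          · have := h l hl v hv
            rw [← he, heq, flaggedLE_self, Bool.or_eq_false_iff] at this
            rw [← he, heq, flaggedLE_self]
            exact this.2

/-- Solvability of a finite system of affine inequalities in one unknown. -/
theorem exists_flaggedLE_add_zsmul [Nontrivial A]
    (hdiv : ∀ m : ℕ, m ≠ 0 → ∀ a : A, ∃ b : A, m • b = a) {κ : Type*} (S : Finset κ)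
    (a : κ → A) (m : κ → ℤ) (b : κ → Bool) (h0 : ∀ s ∈ S, m s = 0 → FlaggedLE (b s) (a s) 0)
    (h : ∀ l ∈ S, ∀ u ∈ S, m l < 0 → 0 < m u →
      FlaggedLE (b l || b u) ((m u).natAbs • a l + (m l).natAbs • a u) 0) :
    ∃ t, ∀ s ∈ S, FlaggedLE (b s) (a s + m s • t) 0 := by
  -- r s is the root in t of a s + m s • t; divisibility concerns natural multiples only, hence the
  -- split by the sign of m s.
  have hr : ∀ s, ∃ r : A, m s ≠ 0 → a s = -(m s • r) := by
    intro s
    by_cases hm : m s = 0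
    · exact ⟨0, fun h => absurd hm h⟩
    · obtain ⟨r, hr⟩ := hdiv (m s).natAbs (Int.natAbs_ne_zero.2 hm) (a s)
      rcases lt_or_gt_of_ne hm with hlt | hgt
      · refine ⟨r, fun _ => ?_⟩
        rw [← hr, ← natCast_zsmul, Int.ofNat_natAbs_of_nonpos hlt.le, neg_zsmul]
      · refine ⟨-r, fun _ => ?_⟩
        rw [← hr, ← natCast_zsmul, Int.natAbs_of_nonneg hgt.le, zsmul_neg, neg_neg]
  choose r hr using hr
  have hlow : ∀ s, m s < 0 → ∀ t, a s + m s • t = (m s).natAbs • (r s - t) := by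
    intro s hs t
    rw [hr s hs.ne, ← natCast_zsmul, Int.ofNat_natAbs_of_nonpos hs.le]
    module
  have hup : ∀ s, 0 < m s → ∀ t, a s + m s • t = (m s).natAbs • (t - r s) := by
    intro s hs t
    rw [hr s hs.ne', ← natCast_zsmul, Int.natAbs_of_nonneg hs.le]
    module
  obtain ⟨t, h1, h2⟩ := exists_flaggedLE_between hdiv (S.filter fun s => m s < 0)
    (S.filter fun s => 0 < m s) r b (by
      intro l hl u hu
      rw [Finset.mem_filter] at hl hu
      have := h l hl.1 u hu.1 hl.2 hu.2
      have e : (m u).natAbs • a l + (m l).natAbs • a u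
          = ((m u).natAbs * (m l).natAbs) • (r l - r u) := by
        rw [hr l hl.2.ne, hr u hu.2.ne']
        simp only [← natCast_zsmul, Nat.cast_mul, Int.natAbs_of_nonneg hu.2.le,
          Int.ofNat_natAbs_of_nonpos hl.2.le]
        module
      rw [e, flaggedLE_nsmul_sub] at this
      · exact this
      · exact mul_ne_zero (Int.natAbs_ne_zero.2 hu.2.ne') (Int.natAbs_ne_zero.2 hl.2.ne))
  refine ⟨t, fun s hs => ?_⟩
  rcases lt_trichotomy (m s) 0 with hlt | heq | hgt
  · rw [hlow s hlt, flaggedLE_nsmul_sub (Int.natAbs_ne_zero.2 hlt.ne)]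
    exact h1 s (Finset.mem_filter.2 ⟨hs, hlt⟩)
  · rw [heq, zero_zsmul, add_zero]
    exact h0 s hs heq
  · rw [hup s hgt, flaggedLE_nsmul_sub (Int.natAbs_ne_zero.2 hgt.ne')]
    exact h2 s (Finset.mem_filter.2 ⟨hs, hgt⟩)

/-- A predicate that is closed under (flagged) addition is closed under positive multiples. -/
theorem nsmul_mem_of_add_mem {M : Type*} [AddMonoid M] {Q : M → Bool → Prop}
    (hQ : ∀ φ ψ s t, Q φ s → Q ψ t → Q (φ + ψ) (s || t)) {φ : M} {s : Bool} (h : Q φ s)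
    {m : ℕ} (hm : m ≠ 0) : Q (m • φ) s := by
  induction m with
  | zero => exact absurd rfl hm
  | succ k ih =>
    by_cases hk : k = 0
    · subst hk; simpa using h
    · have := hQ _ _ _ _ (ih hk) h
      rwa [Bool.or_self, ← succ_nsmul] at this

/-- A form of Farkas' lemma: an unsolvable finite system of strict and weak affine inequalities
with integer slopes has a contradictory consequence, obtained by adding up inequalities. -/
theorem exists_contradiction_of_unsolvable [Nontrivial A]
    (hdiv : ∀ m : ℕ, m ≠ 0 → ∀ a : A, ∃ b : A, m • b = a)
    {Q : A × (ι → ℤ) → Bool → Prop} (hQ : ∀ φ ψ s t, Q φ s → Q ψ t → Q (φ + ψ) (s || t))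
    (S : Finset ((A × (ι → ℤ)) × Bool)) (hS : ∀ φ ∈ S, Q φ.1 φ.2)
    (hunsolv : ∀ x : ι → A, ∃ φ ∈ S, ¬ FlaggedLE φ.2 (affineEval x φ.1) 0) :
    ∃ c b, Q (c, 0) b ∧ ¬ FlaggedLE b c 0 := by
  classical
  -- Induction on a set J containing all the unknowns that still occur, with S arbitrary because
  -- elimination replaces the system.
  suffices H : ∀ (J : Finset ι) (S : Finset ((A × (ι → ℤ)) × Bool)), (∀ φ ∈ S, Q φ.1 φ.2) →
      (∀ φ ∈ S, ∀ i ∉ J, φ.1.2 i = 0) →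
      (∀ x : ι → A, ∃ φ ∈ S, ¬ FlaggedLE φ.2 (affineEval x φ.1) 0) →
      ∃ c b, Q (c, 0) b ∧ ¬ FlaggedLE b c 0 from
    H Finset.univ S hS (fun _ _ i hi => absurd (Finset.mem_univ i) hi) hunsolv
  intro J
  induction J using Finset.induction_on with
  | empty =>
    intro S hS h0 hun
    obtain ⟨φ, hφ, hφ'⟩ := hun 0
    have e : φ.1.2 = 0 := funext fun i => h0 φ hφ i (Finset.notMem_empty i)
    refine ⟨φ.1.1, φ.2, ?_, ?_⟩
    · rw [← e]; exact hS φ hφ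
    · simpa [affineEval_apply] using hφ'
  | insert i J hi ih =>
    intro S hS h0 hun
    -- The positive multipliers are the absolute slopes of the other form in direction i. As the
    -- slopes have opposite signs, xᵢ cancels.
    let comb : ((A × (ι → ℤ)) × Bool) × ((A × (ι → ℤ)) × Bool) → (A × (ι → ℤ)) × Bool :=
      fun p => ((p.2.1.2 i).natAbs • p.1.1 + (p.1.1.2 i).natAbs • p.2.1, p.1.2 || p.2.2)
    let T := (S.filter fun φ => φ.1.2 i = 0) ∪
      (((S.filter fun φ => φ.1.2 i < 0) ×ˢ (S.filter fun φ => 0 < φ.1.2 i)).image comb)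
    refine ih T ?_ ?_ ?_
    · intro φ hφ
      rcases Finset.mem_union.1 hφ with h | h
      · exact hS φ (Finset.mem_filter.1 h).1
      · obtain ⟨⟨l, u⟩, hp, rfl⟩ := Finset.mem_image.1 h
        simp only [Finset.mem_product, Finset.mem_filter] at hp
        exact hQ _ _ _ _
          (nsmul_mem_of_add_mem hQ (hS l hp.1.1) (Int.natAbs_ne_zero.2 hp.2.2.ne'))
          (nsmul_mem_of_add_mem hQ (hS u hp.2.1) (Int.natAbs_ne_zero.2 hp.1.2.ne))
    · intro φ hφ j hj
      rcases Finset.mem_union.1 hφ with h | h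
      · obtain ⟨h1, h2⟩ := Finset.mem_filter.1 h
        by_cases hji : j = i
        · exact hji ▸ h2
        · exact h0 φ h1 j (by simp [hji, hj])
      · obtain ⟨⟨l, u⟩, hp, rfl⟩ := Finset.mem_image.1 h
        simp only [Finset.mem_product, Finset.mem_filter] at hp
        simp only [comb, Prod.snd_add, Prod.smul_snd, Pi.add_apply, Pi.smul_apply]
        by_cases hji : j = i
        · subst hji
          rw [← natCast_zsmul, ← natCast_zsmul, Int.natAbs_of_nonneg hp.2.2.le,
            Int.ofNat_natAbs_of_nonpos hp.1.2.le, smul_eq_mul, smul_eq_mul]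
          ring
        · rw [h0 l hp.1.1 j (by simp [hji, hj]), h0 u hp.2.1 j (by simp [hji, hj])]
          simp
    · intro x
      by_contra! hx
      -- A solution x of the eliminated system T would extend to one of S by moving xᵢ alone.
      obtain ⟨t, ht⟩ := exists_flaggedLE_add_zsmul hdiv S (fun φ => affineEval x φ.1)
        (fun φ => φ.1.2 i) (fun φ => φ.2)
        (fun φ hφ h => hx φ (Finset.mem_union_left _ (Finset.mem_filter.2 ⟨hφ, h⟩)))
        (fun l hl u hu h1 h2 => by
          have := hx (comb (l, u)) (Finset.mem_union_right _ (Finset.mem_image_of_mem _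
            (Finset.mem_product.2 ⟨Finset.mem_filter.2 ⟨hl, h1⟩, Finset.mem_filter.2 ⟨hu, h2⟩⟩)))
          simpa only [comb, map_add, map_nsmul] using this)
      obtain ⟨φ, hφ, hφ'⟩ := hun (Function.update x i (x i + t))
      rw [affineEval_update] at hφ'
      exact hφ' (ht φ hφ)

/-- Let `f ≥ 0` and `0 ≤ g ≤ C` be affine on a polyhedron. If `g` vanishes wherever `f` does, then
`g` is bounded by a multiple of `f`. -/
theorem exists_le_nsmul_of_affine [Nontrivial A]
    (hdiv : ∀ m : ℕ, m ≠ 0 → ∀ a : A, ∃ b : A, m • b = a)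
    (harch : ∀ c C : A, 0 < c → ∃ N : ℕ, C ≤ N • c)
    (P : Finset (A × (ι → ℤ))) (f g : A × (ι → ℤ)) (C : A)
    (hf : ∀ x, (∀ φ ∈ P, affineEval x φ ≤ 0) → 0 ≤ affineEval x f)
    (hg : ∀ x, (∀ φ ∈ P, affineEval x φ ≤ 0) → 0 ≤ affineEval x g)
    (hC : ∀ x, (∀ φ ∈ P, affineEval x φ ≤ 0) → affineEval x g ≤ C)
    (hfg : ∀ x, (∀ φ ∈ P, affineEval x φ ≤ 0) → affineEval x f = 0 → affineEval x g = 0) :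
    ∃ k : ℕ, ∀ x, (∀ φ ∈ P, affineEval x φ ≤ 0) → affineEval x g ≤ k • affineEval x f := by
  classical
  -- Q records the consequences φ of f ≤ 0, -g < 0 and the inequalities of P, where f was used μ
  -- times and -g was used ν times. A strict consequence must have used -g, hence ν ≠ 0.
  let Q : A × (ι → ℤ) → Bool → Prop := fun φ b => ∃ μ ν : ℕ, (b = true → ν ≠ 0) ∧
    ∀ x, (∀ φ ∈ P, affineEval x φ ≤ 0) →
      affineEval x φ + ν • affineEval x g ≤ μ • affineEval x f
  have hQ : ∀ φ ψ s t, Q φ s → Q ψ t → Q (φ + ψ) (s || t) := by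
    rintro φ ψ s t ⟨μ, ν, h1, h2⟩ ⟨μ', ν', h1', h2'⟩
    refine ⟨μ + μ', ν + ν', fun h => ?_, fun x hx => ?_⟩
    · rcases Bool.or_eq_true_iff.1 h with h | h
      · have := h1 h; omega
      · have := h1' h; omega
    · have := add_le_add (h2 x hx) (h2' x hx)
      rw [map_add, add_nsmul, add_nsmul]
      rwa [add_add_add_comm] at this
  obtain ⟨c, b, ⟨μ, ν, hν, h⟩, hc⟩ := exists_contradiction_of_unsolvable hdiv hQ
    (insert (f, false) (insert (-g, true) (P.image fun φ => (φ, false))))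
    (by
      intro φ hφ
      simp only [Finset.mem_insert, Finset.mem_image] at hφ
      rcases hφ with rfl | rfl | ⟨φ, hφ, rfl⟩
      · exact ⟨1, 0, by simp, fun x _ => by simp⟩
      · exact ⟨0, 1, by simp, fun x _ => by simp⟩
      · exact ⟨0, 0, by simp, fun x hx => by simpa using hx φ hφ⟩)
    (by
      intro x
      by_contra! hx
      have hP : ∀ φ ∈ P, affineEval x φ ≤ 0 := fun φ hφ =>
        (hx (φ, false) (by simp [hφ])).le
      have h1 : affineEval x f ≤ 0 := (hx (f, false) (by simp)).le
      have h2 := hx (-g, true) (by simp)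
      simp only [FlaggedLE, if_true, map_neg, neg_neg_iff_pos] at h2
      exact h2.ne' (hfg x hP (h1.antisymm (hf x hP))))
  have hce : ∀ x : ι → A, affineEval x (c, (0 : ι → ℤ)) = c := fun x => by simp [affineEval_apply]
  -- A weak contradiction means c > 0, a strict one means c ≥ 0 and ν ≥ 1.
  cases b
  · simp only [FlaggedLE, Bool.false_eq_true, if_false, not_le] at hc
    obtain ⟨N, hN⟩ := harch c C hc
    refine ⟨N * μ, fun x hx => (hC x hx).trans (hN.trans ?_)⟩
    rw [mul_nsmul']
    refine nsmul_le_nsmul_right ?_ N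
    have := h x hx
    rw [hce] at this
    exact (le_add_of_nonneg_right (nsmul_nonneg (hg x hx) ν)).trans this
  · simp only [FlaggedLE, if_true, not_lt] at hc
    refine ⟨μ, fun x hx => ?_⟩
    have := h x hx
    rw [hce] at this
    calc affineEval x g = 1 • affineEval x g := (one_nsmul _).symm
      _ ≤ ν • affineEval x g :=
        nsmul_le_nsmul_left (hg x hx) (Nat.one_le_iff_ne_zero.2 (hν rfl))
      _ ≤ c + ν • affineEval x g := le_add_of_nonneg_left hc
      _ ≤ _ := this

/-- Let `f = p 0 - p 1 ≥ 0` and `0 ≤ g = p 2 - p 3 ≤ C` be differences of maxima of finitely many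
affine forms. If `g` vanishes wherever `f` does, then `g` is bounded by a multiple of `f`. -/
theorem exists_le_nsmul_of_piecewise_affine [Nontrivial A]
    (hdiv : ∀ m : ℕ, m ≠ 0 → ∀ a : A, ∃ b : A, m • b = a)
    (harch : ∀ c C : A, 0 < c → ∃ N : ℕ, C ≤ N • c)
    (P : Fin 4 → Finset (A × (ι → ℤ))) (p : Fin 4 → (ι → A) → A)
    (hp : ∀ j x, IsGreatest ((fun φ => affineEval x φ) '' (P j : Set (A × (ι → ℤ)))) (p j x))
    (C : A) (hf : ∀ x, 0 ≤ p 0 x - p 1 x) (hg : ∀ x, 0 ≤ p 2 x - p 3 x)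
    (hC : ∀ x, p 2 x - p 3 x ≤ C) (hfg : ∀ x, p 0 x - p 1 x = 0 → p 2 x - p 3 x = 0) :
    ∃ k : ℕ, ∀ x, p 2 x - p 3 x ≤ k • (p 0 x - p 1 x) := by
  classical
  -- The polyhedron on which, for every j, the form φ j attains the maximum p j.
  let region : (Fin 4 → A × (ι → ℤ)) → Finset (A × (ι → ℤ)) := fun φ =>
    Finset.univ.biUnion fun j => (P j).image fun ψ => ψ - φ j
  have key : ∀ φ ∈ Fintype.piFinset P, ∀ x, (∀ ψ ∈ region φ, affineEval x ψ ≤ 0) →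
      ∀ j, affineEval x (φ j) = p j x := by
    intro φ hφ x hx j
    refine IsGreatest.unique (s := (fun φ => affineEval x φ) '' (P j : Set (A × (ι → ℤ))))
      ⟨⟨φ j, Fintype.mem_piFinset.1 hφ j, rfl⟩, ?_⟩ (hp j x)
    rintro _ ⟨ψ, hψ, rfl⟩
    have := hx (ψ - φ j) (Finset.mem_biUnion.2 ⟨j, Finset.mem_univ j,
      Finset.mem_image_of_mem _ hψ⟩)
    rwa [map_sub, sub_nonpos] at this
  have hk : ∀ φ : Fin 4 → A × (ι → ℤ), ∃ k : ℕ, φ ∈ Fintype.piFinset P →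
      ∀ x, (∀ ψ ∈ region φ, affineEval x ψ ≤ 0) → p 2 x - p 3 x ≤ k • (p 0 x - p 1 x) := by
    intro φ
    by_cases hφ : φ ∈ Fintype.piFinset P
    · have e := key φ hφ
      obtain ⟨k, hk⟩ := exists_le_nsmul_of_affine hdiv harch (region φ) (φ 0 - φ 1) (φ 2 - φ 3) C
        (fun x hx => by rw [map_sub, e x hx, e x hx]; exact hf x)
        (fun x hx => by rw [map_sub, e x hx, e x hx]; exact hg x)
        (fun x hx => by rw [map_sub, e x hx, e x hx]; exact hC x)
        (fun x hx => by simp only [map_sub, e x hx]; exact hfg x)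
      refine ⟨k, fun _ x hx => ?_⟩
      have := hk x hx
      simpa only [map_sub, e x hx] using this
    · exact ⟨0, fun h => absurd h hφ⟩
  choose k hk using hk
  -- Every x lies in the region of some choice of maximizing forms, and since f ≥ 0 the largest of
  -- the finitely many k serves for all of them.
  refine ⟨(Fintype.piFinset P).sup k, fun x => ?_⟩
  have hmax : ∀ j, ∃ φ ∈ P j, affineEval x φ = p j x := fun j => (hp j x).1
  choose φ hφ hφ' using hmax
  have hmem : φ ∈ Fintype.piFinset P := Fintype.mem_piFinset.2 hφ
  refine (hk φ hmem x fun ψ hψ => ?_).trans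
    (nsmul_le_nsmul_left (hf x) (Finset.le_sup (f := k) hmem))
  obtain ⟨j, -, hj⟩ := Finset.mem_biUnion.1 hψ
  obtain ⟨ψ, hψ', rfl⟩ := Finset.mem_image.1 hj
  rw [map_sub, sub_nonpos, hφ' j]
  exact (hp j x).2 (Set.mem_image_of_mem _ hψ')

end FourierMotzkin

/-! ### Kernels of idempotent semifields -/

section Kernels

variable {H : Type*} [ZeroFreeSemifield H]

namespace SemifieldKernel

theorem mem_closure {A : Set H} {h : H} :
    h ∈ closure A ↔ ∀ K : SemifieldKernel H, A ⊆ K → h ∈ K := Iff.rfl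

theorem mem_principal {a h : H} :
    h ∈ principal a ↔ ∀ K : SemifieldKernel H, a ∈ K → h ∈ K := by
  simp only [principal, mem_closure, Set.singleton_subset_iff, SetLike.mem_coe]

instance : SubgroupClass (SemifieldKernel H) H where
  mul_mem {K} := K.toSubgroup.mul_mem
  one_mem K := K.toSubgroup.one_mem
  inv_mem {K} := K.toSubgroup.inv_mem

/-- Kernels are convex for the order `a ≤ b ↔ a + b = b`. -/
theorem mem_of_add_eq (K : SemifieldKernel H) {a b h : H} (ha : a ∈ K) (hb : b ∈ K)
    (h1 : a + h = h) (h2 : h + b = b) : h ∈ K := by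
  -- h ≤ b makes 1 and h b⁻¹ admissible weights; the combination 1 · a + (h b⁻¹) · b = a + h is h
  -- itself.
  have hsum : 1 + h * b⁻¹ = 1 := by
    rw [← mul_inv_cancel b, ← add_mul, add_comm, h2]
  have := K.convex' hsum ha hb
  rwa [one_mul, inv_mul_cancel_right, h1] at this

theorem add_mem [IsIdempotentSemifield H] (K : SemifieldKernel H) {a b : H} (ha : a ∈ K)
    (hb : b ∈ K) : a + b ∈ K :=
  K.toSubSemifield.add_mem' ha hb

/-- The kernel of a semifield homomorphism. -/
def ofHom {L : Type*} [ZeroFreeSemifield L] [IsIdempotentSemifield L] (φ : H → L)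
    (hφ : IsSemifieldHom φ) : SemifieldKernel H :=
  { (MonoidHom.mk' φ hφ.map_mul).ker with
    convex' := by
      intro x y a b hxy ha hb
      change φ a = 1 at ha
      change φ b = 1 at hb
      change φ (x * a + y * b) = 1
      rw [hφ.map_add, hφ.map_mul, hφ.map_mul, ha, hb, mul_one, mul_one, ← hφ.map_add, hxy]
      exact (MonoidHom.mk' φ hφ.map_mul).map_one }

/-- The first isomorphism theorem for semifields. -/
theorem exists_quotient_equiv {L : Type*} [ZeroFreeSemifield L] (K : SemifieldKernel H)
    {φ : H → L} (hφ : IsSemifieldHom φ) (hsurj : Function.Surjective φ)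
    (hK : ∀ h, φ h = 1 ↔ h ∈ K) :
    ∃ e : K.Quotient ≃+* L, ∀ h : H, e (Quotient.mk K h) = φ h := by
  let F : H →* L := MonoidHom.mk' φ hφ.map_mul
  let G : H ⧸ K.toSubgroup →* L := QuotientGroup.lift K.toSubgroup F fun h hh => (hK h).2 hh
  have hG : ∀ h : H, G (QuotientGroup.mk h) = φ h := fun _ => rfl
  have hbij : Function.Bijective G := by
    refine ⟨(injective_iff_map_eq_one G).2 ?_, fun l => ?_⟩
    · rintro ⟨h⟩ hh
      exact (QuotientGroup.eq_one_iff h).2 ((hK h).1 hh)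
    · obtain ⟨h, rfl⟩ := hsurj l
      exact ⟨QuotientGroup.mk h, rfl⟩
  refine ⟨{ Equiv.ofBijective G hbij with
    map_mul' := fun a b => G.map_mul a b
    map_add' := ?_ }, fun h => rfl⟩
  rintro ⟨a⟩ ⟨b⟩
  exact hφ.map_add a b

end SemifieldKernel

end Kernels

/-! ### Rational functions over the base semifield -/

section RationalFunctions

variable {n : ℕ}

theorem isSemifieldHom_restrictionMap {R : Type*} [MaxSemifield R] (V : Set (Fin n → R)) :
    IsSemifieldHom (restrictionMap V) :=
  ⟨fun _ _ => rfl, fun _ _ => rfl⟩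

theorem restrictionMap_surjective {R : Type*} [MaxSemifield R] (V : Set (Fin n → R)) :
    Function.Surjective (restrictionMap V) := by
  rintro ⟨_, g, rfl⟩
  exact ⟨g, rfl⟩

theorem restrictionMap_eq_one_iff {R : Type*} [MaxSemifield R] {V : Set (Fin n → R)}
    {g : ConstSemifield n R} : restrictionMap V g = 1 ↔ ∀ x ∈ V, g.eval x = 1 := by
  rw [Subtype.ext_iff, funext_iff]
  exact Subtype.forall

theorem MaxSemifield.add_eq_right_iff {R : Type*} [MaxSemifield R] {a b : R} :
    a + b = b ↔ a ≤ b := by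
  rw [MaxSemifield.add_eq_max, max_eq_right_iff]

/-- The kernel of all rational functions `f` such that `f` and `f⁻¹` are bounded by constants. -/
def boundedKernel (n : ℕ) (R : Type*) [MaxSemifield R] :
    SemifieldKernel (fractionSemifield n R) where
  carrier := {f | ∃ C : R, ∀ x, f.1 x ≤ C ∧ (f.1 x)⁻¹ ≤ C}
  mul_mem' := by
    rintro f g ⟨C, hC⟩ ⟨D, hD⟩
    refine ⟨C * D, fun x => ⟨mul_le_mul' (hC x).1 (hD x).1, ?_⟩⟩
    change (f.1 x * g.1 x)⁻¹ ≤ _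
    rw [mul_inv]
    exact mul_le_mul' (hC x).2 (hD x).2
  one_mem' := ⟨1, fun x => ⟨le_refl (1 : R), inv_one.le⟩⟩
  inv_mem' := by
    rintro f ⟨C, hC⟩
    exact ⟨C, fun x => ⟨(hC x).2, (inv_inv (f.1 x)).le.trans (hC x).1⟩⟩
  convex' := by
    rintro u v f g huv ⟨C, hC⟩ ⟨D, hD⟩
    refine ⟨max C D, fun x => ?_⟩
    have h1 : max (u.1 x) (v.1 x) = 1 := by
      rw [← MaxSemifield.add_eq_max]
      exact congrFun (congrArg Subtype.val huv) x
    change u.1 x * f.1 x + v.1 x * g.1 x ≤ _ ∧ (u.1 x * f.1 x + v.1 x * g.1 x)⁻¹ ≤ _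
    rw [MaxSemifield.add_eq_max]
    constructor
    · refine max_le ?_ ?_
      · exact (mul_le_of_le_one_left' (h1 ▸ le_max_left _ _)).trans ((hC x).1.trans (le_max_left _ _))
      · exact (mul_le_of_le_one_left' (h1 ▸ le_max_right _ _)).trans
          ((hD x).1.trans (le_max_right _ _))
    -- One of the weights equals 1 at x, so the sum is at least f x or at least g x there; this
    -- bounds its inverse.
    · rcases max_choice (u.1 x) (v.1 x) with h | h
      · rw [h] at h1
        rw [h1, one_mul]
        exact (inv_le_inv_iff.2 (le_max_left _ _)).trans ((hC x).2.trans (le_max_left _ _))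
      · rw [h] at h1
        rw [h1, one_mul]
        exact (inv_le_inv_iff.2 (le_max_right _ _)).trans ((hD x).2.trans (le_max_right _ _))

/-- The bounded functions form a kernel containing the constants, hence containing `⟨R⟩`. -/
theorem ConstSemifield.exists_bound {R : Type*} [MaxSemifield R] (g : ConstSemifield n R) :
    ∃ C : R, ∀ x, g.eval x ≤ C ∧ (g.eval x)⁻¹ ≤ C := by
  refine g.2 (boundedKernel n R) ?_
  rintro _ ⟨α, rfl⟩
  exact ⟨max α α⁻¹, fun x => ⟨le_max_left _ _, le_max_right _ _⟩⟩

/-- Evaluation at a point. -/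
theorem ConstSemifield.isSemifieldHom_eval {R : Type*} [MaxSemifield R] (x : Fin n → R) :
    IsSemifieldHom fun g : ConstSemifield n R => g.eval x :=
  ⟨fun _ _ => rfl, fun _ _ => rfl⟩

/-- Evaluation at x is a homomorphism, and if f(x) = 1 its kernel contains f and therefore all of
⟨f⟩. -/
theorem mem_skel_principal_iff {R : Type*} [MaxSemifield R] {f : ConstSemifield n R}
    {x : Fin n → R} :
    x ∈ skel (SemifieldKernel.principal f : Set (ConstSemifield n R)) ↔ f.eval x = 1 := by
  refine ⟨fun h => h f (SemifieldKernel.mem_principal.2 fun _ hK => hK), fun h g hg => ?_⟩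
  exact SemifieldKernel.mem_principal.1 hg
    (SemifieldKernel.ofHom _ (ConstSemifield.isSemifieldHom_eval x)) h

/-- A polynomial function is the pointwise maximum of finitely many affine forms. -/
theorem IsPolynomialFun.exists_isGreatest {R : Type*} [MaxSemifield R] {p : (Fin n → R) → R}
    (hp : IsPolynomialFun p) :
    ∃ P : Finset (Additive R × (Fin n → ℤ)), ∀ x : Fin n → Additive R,
      IsGreatest ((fun φ => affineEval x φ) '' (P : Set (Additive R × (Fin n → ℤ))))
        (Additive.ofMul (p fun i => (x i).toMul)) := by
  classical
  induction hp with
  | monomial α k =>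
    refine ⟨{(Additive.ofMul α, fun i => (k i : ℤ))}, fun x => ?_⟩
    rw [Finset.coe_singleton, Set.image_singleton]
    have e : Additive.ofMul (α * ∏ i, (x i).toMul ^ k i) =
        affineEval x (Additive.ofMul α, fun i => (k i : ℤ)) := by
      simp [affineEval_apply, ofMul_prod]
    rw [e]
    exact isGreatest_singleton
  | @add p q _ _ ihp ihq =>
    obtain ⟨P, hP⟩ := ihp
    obtain ⟨Q, hQ⟩ := ihq
    refine ⟨P ∪ Q, fun x => ?_⟩
    rw [Finset.coe_union, Set.image_union]
    have e : Additive.ofMul ((p + q) fun i => (x i).toMul) =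
        max (Additive.ofMul (p fun i => (x i).toMul)) (Additive.ofMul (q fun i => (x i).toMul)) :=
      congrArg Additive.ofMul (MaxSemifield.add_eq_max _ _)
    rw [e]
    exact (hP x).union (hQ x)

theorem DesignatedSemifield.exists_le_pow {R : Type*} [DesignatedSemifield R] {c : R} (hc : 1 < c)
    (C : R) : ∃ N : ℕ, C ≤ c ^ N := by
  by_contra! h
  refine hc.ne' (DesignatedSemifield.archimedean c C fun k => ?_)
  obtain ⟨m, rfl | rfl⟩ := k.eq_nat_or_neg
  · rw [zpow_natCast]
    exact (h m).le
  -- Negative powers of c are at most 1 = c ^ 0, which C exceeds by assumption.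
  · rw [zpow_neg, zpow_natCast]
    refine (inv_le_one'.2 (one_le_pow_of_one_le' hc.le m)).trans ?_
    simpa using (h 0).le

/-- If `f, g ≥ 1` are rational functions, `g` is bounded, and `g = 1` wherever `f = 1`, then `g` is
bounded by a power of `f`. -/
theorem exists_le_pow_of_rational {R : Type*} [DesignatedSemifield R] {f g : (Fin n → R) → R}
    (hf : f ∈ fractionSemifield n R) (hg : g ∈ fractionSemifield n R)
    (hf1 : ∀ x, 1 ≤ f x) (hg1 : ∀ x, 1 ≤ g x) {C : R} (hC : ∀ x, g x ≤ C)
    (hfg : ∀ x, f x = 1 → g x = 1) : ∃ k : ℕ, ∀ x, g x ≤ f x ^ k := by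
  rcases subsingleton_or_nontrivial R with hR | hR
  · exact ⟨0, fun x => (Subsingleton.elim _ _).le⟩
  obtain ⟨p, q, hp, hq, rfl⟩ := hf
  obtain ⟨p', q', hp', hq', rfl⟩ := hg
  obtain ⟨P, hP⟩ := hp.exists_isGreatest
  obtain ⟨Q, hQ⟩ := hq.exists_isGreatest
  obtain ⟨P', hP'⟩ := hp'.exists_isGreatest
  obtain ⟨Q', hQ'⟩ := hq'.exists_isGreatest
  -- In `Additive R` differences are quotients and multiples are powers, so the hypotheses and the
  -- conclusion transfer definitionally.
  obtain ⟨k, hk⟩ := exists_le_nsmul_of_piecewise_affine (A := Additive R)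
    (fun m hm a => DesignatedSemifield.divisible m hm a.toMul)
    (fun c C hc => DesignatedSemifield.exists_le_pow (c := c.toMul) hc C.toMul)
    ![P, Q, P', Q']
    (fun j x => Additive.ofMul ((![p, q, p', q'] : Fin 4 → (Fin n → R) → R) j fun i => (x i).toMul))
    (by
      intro j x
      fin_cases j
      exacts [hP x, hQ x, hP' x, hQ' x])
    (Additive.ofMul C) (fun x => hf1 _) (fun x => hg1 _) (fun x => hC _) (fun x => hfg _)
  exact ⟨k, fun x => hk fun i => Additive.ofMul (x i)⟩

/-- The element a + a⁻¹ is the multiplicative absolute value of a. It replaces f and g by functions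
that are at least 1 and take the value 1 at the same points. -/
theorem one_le_add_inv {R : Type*} [MaxSemifield R] (a : R) : 1 ≤ a + a⁻¹ := by
  rw [MaxSemifield.add_eq_max, le_max_iff]
  exact (le_total 1 a).imp id one_le_inv'.2

theorem add_inv_eq_one_iff {R : Type*} [MaxSemifield R] {a : R} : a + a⁻¹ = 1 ↔ a = 1 := by
  rw [MaxSemifield.add_eq_max]
  refine ⟨fun h => le_antisymm (h ▸ le_max_left _ _) (inv_le_one'.1 (h ▸ le_max_right _ _)), ?_⟩
  rintro rfl
  rw [inv_one, max_self]

/-- The Nullstellensatz for principal kernels of `⟨R⟩`. -/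
theorem mem_principal_of_forall_eval_eq_one {R : Type*} [DesignatedSemifield R]
    {f g : ConstSemifield n R} (h : ∀ x, f.eval x = 1 → g.eval x = 1) :
    g ∈ SemifieldKernel.principal f := by
  obtain ⟨C, hC⟩ := g.exists_bound
  obtain ⟨k, hk⟩ := exists_le_pow_of_rational (f + f⁻¹).1.2 (g + g⁻¹).1.2
    (fun x => one_le_add_inv (f.eval x)) (fun x => one_le_add_inv (g.eval x)) (C := C)
    (fun x => (MaxSemifield.add_eq_max (g.eval x) _).trans_le (max_le (hC x).1 (hC x).2))
    (fun x hx => add_inv_eq_one_iff.2 (h x (add_inv_eq_one_iff.1 hx)))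
  have hle : ∀ x, g.eval x ≤ (f.eval x + (f.eval x)⁻¹) ^ k ∧
      (g.eval x)⁻¹ ≤ (f.eval x + (f.eval x)⁻¹) ^ k := fun x =>
    max_le_iff.1 ((MaxSemifield.add_eq_max (g.eval x) _).symm.trans_le (hk x))
  refine SemifieldKernel.mem_principal.2 fun K hf => ?_
  -- Any kernel containing f contains |f|^k and its inverse, and g lies between the two.
  have hF : (f + f⁻¹) ^ k ∈ K := pow_mem (K.add_mem hf (inv_mem hf)) k
  refine K.mem_of_add_eq (inv_mem hF) hF ?_ ?_
  · refine Subtype.ext (Subtype.ext (funext fun x => ?_))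
    exact MaxSemifield.add_eq_right_iff.2 (inv_le'.1 (hle x).2)
  · refine Subtype.ext (Subtype.ext (funext fun x => ?_))
    exact MaxSemifield.add_eq_right_iff.2 (hle x).1

end RationalFunctions

theorem mainTheorem12 {R : Type*} [DesignatedSemifield R] (n : ℕ) (f : ConstSemifield n R)
    (V : Set (Fin n → R)) (hV : V = skel (SemifieldKernel.principal f : Set (ConstSemifield n R))) :
    IsSemifieldHom (restrictionMap V) ∧
    Function.Surjective (restrictionMap V) ∧
    {g : ConstSemifield n R | restrictionMap V g = 1} = SemifieldKernel.principal f ∧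
    ∃ e : (SemifieldKernel.principal f).Quotient ≃+* coordinateSemifield V,
      ∀ g : ConstSemifield n R,
        e (SemifieldKernel.Quotient.mk (SemifieldKernel.principal f) g) = restrictionMap V g := by
  have hker : ∀ g, restrictionMap V g = 1 ↔ g ∈ SemifieldKernel.principal f := by
    intro g
    rw [restrictionMap_eq_one_iff, hV]
    refine ⟨fun h => mem_principal_of_forall_eval_eq_one fun x hx =>
      h x (mem_skel_principal_iff.2 hx), fun hg x hx => hx g hg⟩
  exact ⟨isSemifieldHom_restrictionMap V, restrictionMap_surjective V, Set.ext hker,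
    SemifieldKernel.exists_quotient_equiv _ (isSemifieldHom_restrictionMap V)
      (restrictionMap_surjective V) hker⟩
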